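/- Throughout, let $E$ be a finite-dimensional real inner product space. A polytope in $E$ is \emph{inscribed} if its vertices lie on a common sphere. A \emph{zonotope} is a Minkowski sum of finitely many segments. For a polytope $P$, a non-empty face $F$ of $P$ has normal cone $N_FP=\{c\in E: F\subseteq P^c\}$, where $P^c$ is the face of $P$ on which $x\mapsto\langle c,x\rangle$ attains its maximum over $P$; the \emph{normal fan} of $P$ is $\{N_FP : F \text{ a non-empty face of } P\}$. A (finite) arrangement $\mathcal A$ of linear hyperplanes in $E$ induces a fan $\mathcal N(\mathcal A)$, whose cones are the closures of the connected components of $E\setminus\bigcup\mathcal A$ together with all their non-empty faces. The arrangement $\mathcal A$ is \emph{strongly inscribable} if there is an inscribed zonotope in $E$ with normal fan $\mathcal N(\mathcal A)$. A \emph{flat} of $\mathcal A$ is an intersection of hyperplanes of $\mathcal A$ (the empty intersection being $E$), and the \emph{restriction} of $\mathcal A$ to a flat $L$ is the arrangement $\{H\cap L : H\in\mathcal A,\ L\not\subseteq H\}$ in the inner product space $L$. For $\alpha\in E\setminus\{0\}$ let $s_\alpha$ be the orthogonal reflection in $\alpha^\perp$. A \emph{finite reflection group} is a finite group $W$ of linear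 isometries of $E$ generated by such reflections; its \emph{reflection arrangement} is $\mathcal A_W=\{\alpha^\perp : s_\alpha\in W\}$. A \emph{root system} is a finite (possibly empty) set $\Phi\subset E\setminus\{0\}$ such that $\Phi\cap\mathbb R\alpha=\{-\alpha,\alpha\}$ and $s_\alpha(\Phi)=\Phi$ for all $\alpha\in\Phi$; it is a root system \emph{of} $W$ if $W$ is generated by the reflections $s_\alpha$, $\alpha\in\Phi$. The \emph{Coxeter zonotope} of $\Phi$ is the Minkowski sum $Z_\Phi=\sum_{\alpha\in\Phi}[-\alpha,\alpha]$. \textbf{Proposition.} Let $W$ be a finite reflection group in $E$. \begin{enumerate} \item $W$ has a root system, and for every root system $\Phi$ of $W$ the Coxeter zonotope $Z_\Phi$ is an inscribed zonotope whose normal fan is $\mathcal N(\mathcal A_W)$ and whose vertices form a single $W$-orbit. In particular, $\mathcal A_W$ is strongly inscribable. \item For every flat $L$ of $\mathcal A_W$, the restriction of $\mathcal A_W$ to $L$ is a strongly inscribable arrangement in $L$. \end{enumerate} -/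

import Mathlib

open scoped Pointwise InnerProductSpace

noncomputable section

namespace InscribedArrangement

variable {E : Type*} [NormedAddCommGroup E] [InnerProductSpace ℝ E]

/-! ## Polytopes, faces, normal fans -/

/-- A (non-empty) convex polytope: the convex hull of a non-empty finite set of points. -/
def IsPolytope (P : Set E) : Prop :=
  ∃ S : Set E, S.Finite ∧ S.Nonempty ∧ P = convexHull ℝ S

/-- The vertices of `P`, that is, its extreme points. -/
def vertices (P : Set E) : Set E := P.extremePoints ℝ

/-- A polytope is inscribed if its vertices lie on a common sphere. -/
def IsInscribed (P : Set E) : Prop :=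
  IsPolytope P ∧ EuclideanGeometry.Cospherical (vertices P)

/-- The set `P^c` of points of `P` that maximize the linear function `x ↦ ⟪c, x⟫` over `P`. -/
def maxFace (P : Set E) (c : E) : Set E :=
  {x | x ∈ P ∧ ∀ y ∈ P, ⟪c, y⟫_ℝ ≤ ⟪c, x⟫_ℝ}

/-- The non-empty faces of a polyhedron (a polytope or a polyhedral cone). -/
def faces (P : Set E) : Set (Set E) :=
  {F | F.Nonempty ∧ ∃ c : E, F = maxFace P c}

/-- The normal cone `N_F P` of a face `F` of `P`. -/
def normalCone (P F : Set E) : Set E := {c | F ⊆ maxFace P c}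

/-- The normal fan of `P`: the collection of the normal cones of its non-empty faces. -/
def normalFan (P : Set E) : Set (Set E) := normalCone P '' faces P

/-- A zonotope: a Minkowski sum of finitely many segments. -/
def IsZonotope (Z : Set E) : Prop :=
  ∃ (n : ℕ) (a b : Fin n → E), Z = ∑ i, segment ℝ (a i) (b i)

/-! ## Arrangements of linear hyperplanes -/

/-- A finite collection of linear hyperplanes `z^⊥`, `z ≠ 0`. -/
def IsArrangement (A : Set (Submodule ℝ E)) : Prop :=
  A.Finite ∧ ∀ H ∈ A, ∃ z : E, z ≠ 0 ∧ H = (ℝ ∙ z)ᗮ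

/-- The closed cone of all points that lie, for every hyperplane `H` of `A`, weakly on the same
side of `H` as the generic point `c`.  The vectors `z ∈ Hᗮ` with `0 < ⟪z, c⟫` are exactly
the normal vectors of `H` that point to the side of `c`. -/
def regionOf (A : Set (Submodule ℝ E)) (c : E) : Set E :=
  {x | ∀ H ∈ A, ∀ z ∈ Hᗮ, 0 < ⟪z, c⟫_ℝ → 0 ≤ ⟪z, x⟫_ℝ}

/-- The regions of `A`: the cones `regionOf A c` for generic `c` (on no hyperplane of `A`). -/
def regions (A : Set (Submodule ℝ E)) : Set (Set E) :=
  {R | ∃ c : E, (∀ H ∈ A, c ∉ H) ∧ R = regionOf A c}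

/-- The fan induced by `A`: the regions of `A` together with all their non-empty faces. -/
def arrangementFan (A : Set (Submodule ℝ E)) : Set (Set E) :=
  {C | ∃ R ∈ regions A, C ∈ faces R}

/-- A flat of `A`: an intersection of hyperplanes of `A`
(the empty intersection is the whole space). -/
def IsFlat (A : Set (Submodule ℝ E)) (L : Submodule ℝ E) : Prop :=
  ∃ B ⊆ A, L = sInf B

/-- The restriction `{H ∩ L : H ∈ A, L ⊄ H}` of `A` to `L`, an arrangement in the
inner product space `L`. -/
def restriction (A : Set (Submodule ℝ E)) (L : Submodule ℝ E) : Set (Submodule ℝ L) :=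
  {K | ∃ H ∈ A, ¬ L ≤ H ∧ K = H.comap L.subtype}

/-- The arrangement `A` is strongly inscribable: there is an inscribed zonotope whose normal fan
is the fan of `A`. -/
def StronglyInscribable (A : Set (Submodule ℝ E)) : Prop :=
  IsArrangement A ∧
    ∃ Z : Set E, IsZonotope Z ∧ IsInscribed Z ∧ normalFan Z = arrangementFan A

/-! ## Reflection groups and root systems -/

/-- The orthogonal reflection `s_α` in the hyperplane `α^⊥` (used for `α ≠ 0`). -/
def refl (α : E) : E ≃ₗᵢ[ℝ] E := (ℝ ∙ α)ᗮ.reflection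

/-- A finite reflection group: a finite group of linear isometries that is generated by
reflections in linear hyperplanes. -/
def IsFiniteReflectionGroup (W : Subgroup (E ≃ₗᵢ[ℝ] E)) : Prop :=
  Finite W ∧ ∃ S : Set E, (∀ α ∈ S, α ≠ 0) ∧ W = Subgroup.closure (refl '' S)

/-- The reflection arrangement of `W`: all hyperplanes whose reflection lies in `W`. -/
def reflectionArrangement (W : Subgroup (E ≃ₗᵢ[ℝ] E)) : Set (Submodule ℝ E) :=
  {H | ∃ α : E, α ≠ 0 ∧ refl α ∈ W ∧ H = (ℝ ∙ α)ᗮ}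

/-- A (not necessarily crystallographic or spanning) root system.  The empty set is allowed: it is
the root system of the trivial reflection group. -/
structure IsRootSystem (Φ : Finset E) : Prop where
  ne_zero : ∀ α ∈ Φ, α ≠ 0
  inter_line : ∀ α ∈ Φ, (Φ : Set E) ∩ ((ℝ ∙ α : Submodule ℝ E) : Set E) = {-α, α}
  image_refl : ∀ α ∈ Φ, refl α '' (Φ : Set E) = (Φ : Set E)

/-- `Φ` is a root system of `W`: a root system whose reflections generate `W`. -/
def IsRootSystemOf (Φ : Finset E) (W : Subgroup (E ≃ₗᵢ[ℝ] E)) : Prop :=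
  IsRootSystem Φ ∧ Subgroup.closure (refl '' (Φ : Set E)) = W

/-- The Coxeter zonotope `∑_{α ∈ Φ} [-α, α]` (a Minkowski sum). -/
def coxeterZonotope (Φ : Finset E) : Set E := ∑ α ∈ Φ, segment ℝ (-α) α

end InscribedArrangement

end

open scoped Pointwise InnerProductSpace

namespace InscribedArrangement

/-! ## Zonotopes and their sign vectors -/

section Zonotope

variable {ι E : Type*} [NormedAddCommGroup E] [InnerProductSpace ℝ E]

/-! On the zonotope of vectors `a i`, the functional `⟪c, ·⟫` is maximal exactly where each
coefficient agrees with the sign of `⟪a i, c⟫` whenever that is non-zero. Normal cones are therefore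
the sign cells, which are also the faces of the regions of the arrangement
(`normalFan_zonotope_eq_arrangementFan`), and the vertices are the sign sums of generic vectors
(`vertices_zonotope`). Strong inscribability thus reduces to one claim: `‖signSum s a c‖` is the
same for all generic `c`.

For a root system, `W` permutes the roots, so `signSum` is `W`-equivariant; transitivity on chambers
(`exists_signSum_eq`) makes the vertices one orbit, hence of equal norm. That no reflection
hyperplane is missed follows from the product of positive roots, which `W` multiplies by the
determinant (`reflectionArrangement_eq`).

For a flat `L`, the roots are projected to `L`. Projections may vanish or coincide, so zonotopes are
built from indexed families. A sign sum in `L` differs from a vertex upstairs by a fixed vector of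
`Lᗮ`, and Pythagoras transfers the equality of norms (`norm_signSum_flat_eq`). -/

/-- The centrally symmetric zonotope generated by the vectors `a i`, `i ∈ s`. -/
def zonotope (s : Finset ι) (a : ι → E) : Set E := ∑ i ∈ s, segment ℝ (-a i) (a i)

/-- The hyperplanes orthogonal to the non-zero vectors among the `a i`, `i ∈ s`. -/
def hyperplanes (s : Finset ι) (a : ι → E) : Set (Submodule ℝ E) :=
  {H | ∃ i ∈ s, a i ≠ 0 ∧ H = (ℝ ∙ a i)ᗮ}

/-- A vector is generic if it lies on none of the hyperplanes orthogonal to the `a i`. -/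
def IsGeneric (s : Finset ι) (a : ι → E) (c : E) : Prop := ∀ i ∈ s, a i ≠ 0 → ⟪a i, c⟫_ℝ ≠ 0

/-- The sign of a real number, as a real number. -/
noncomputable def sgn (x : ℝ) : ℝ := (SignType.sign x : ℝ)

/-- The point `∑ sign ⟪a i, c⟫ • a i`, at which `⟪c, ·⟫` is maximal on the zonotope. -/
noncomputable def signSum (s : Finset ι) (a : ι → E) (c : E) : E :=
  ∑ i ∈ s, sgn ⟪a i, c⟫_ℝ • a i

/-- The cone of all points weakly on the same side of each hyperplane as `c`, and on those
hyperplanes that contain `c`. -/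
def cell (s : Finset ι) (a : ι → E) (c : E) : Set E :=
  {x | ∀ i ∈ s, sgn ⟪a i, c⟫_ℝ * ⟪a i, x⟫_ℝ = |⟪a i, x⟫_ℝ|}

lemma sgn_pos {x : ℝ} (h : 0 < x) : sgn x = 1 := by simp [sgn, h]

lemma sgn_neg {x : ℝ} (h : x < 0) : sgn x = -1 := by simp [sgn, h]

@[simp] lemma sgn_zero : sgn 0 = 0 := by simp [sgn]

lemma sgn_mul_self (x : ℝ) : sgn x * x = |x| := sign_mul_self x

lemma abs_sgn_le (x : ℝ) : |sgn x| ≤ 1 := by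
  rcases lt_trichotomy x 0 with h | rfl | h
  · simp [sgn_neg h]
  · simp
  · simp [sgn_pos h]

lemma sgn_mul_sgn {x : ℝ} (h : x ≠ 0) : sgn x * sgn x = 1 := by
  rcases lt_or_gt_of_ne h with h | h
  · simp [sgn_neg h]
  · simp [sgn_pos h]

lemma sgn_mul_eq_abs_iff {x y : ℝ} (hx : x ≠ 0) : sgn x * y = |y| ↔ 0 ≤ sgn x * y := by
  refine ⟨fun h ↦ h ▸ abs_nonneg y, fun h ↦ ?_⟩
  rw [← abs_of_nonneg h, abs_mul]
  rcases lt_or_gt_of_ne hx with h | h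
  · simp [sgn_neg h]
  · simp [sgn_pos h]

lemma mem_zonotope {s : Finset ι} {a : ι → E} {x : E} :
    x ∈ zonotope s a ↔ ∃ t : ι → ℝ, (∀ i ∈ s, |t i| ≤ 1) ∧ x = ∑ i ∈ s, t i • a i := by
  classical
  have hseg (v y : E) : y ∈ segment ℝ (-v) v ↔ ∃ t : ℝ, |t| ≤ 1 ∧ y = t • v := by
    rw [segment_eq_image]
    constructor
    · rintro ⟨θ, ⟨h0, h1⟩, rfl⟩
      exact ⟨2 * θ - 1, abs_le.2 ⟨by linarith, by linarith⟩, by module⟩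
    · rintro ⟨t, ht, rfl⟩
      obtain ⟨h0, h1⟩ := abs_le.1 ht
      exact ⟨(t + 1) / 2, ⟨by linarith, by linarith⟩, by module⟩
  rw [zonotope, Set.mem_finsetSum]
  constructor
  · rintro ⟨g, hg, rfl⟩
    choose! t ht htg using fun i (hi : i ∈ s) ↦ (hseg (a i) (g i)).1 (hg hi)
    exact ⟨t, ht, Finset.sum_congr rfl htg⟩
  · rintro ⟨t, ht, rfl⟩
    exact ⟨fun i ↦ t i • a i, fun {i} hi ↦ (hseg _ _).2 ⟨t i, ht i hi, rfl⟩, rfl⟩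

lemma isZonotope_zonotope (s : Finset ι) (a : ι → E) : IsZonotope (zonotope s a) := by
  refine ⟨s.card, fun k ↦ -a (s.equivFin.symm k), fun k ↦ a (s.equivFin.symm k), ?_⟩
  rw [zonotope, ← Finset.sum_coe_sort s]
  exact (Equiv.sum_comp s.equivFin.symm
    (fun i : s ↦ segment ℝ (-a (i : ι)) (a (i : ι)))).symm

lemma convex_zonotope (s : Finset ι) (a : ι → E) : Convex ℝ (zonotope s a) := by
  exact convex_sum _ fun i _ ↦ convex_segment (-a i) (a i)

lemma signSum_mem_zonotope (s : Finset ι) (a : ι → E) (c : E) : signSum s a c ∈ zonotope s a :=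
  mem_zonotope.2 ⟨_, fun _ _ ↦ abs_sgn_le _, rfl⟩

lemma inner_signSum (s : Finset ι) (a : ι → E) (c : E) :
    ⟪c, signSum s a c⟫_ℝ = ∑ i ∈ s, |⟪a i, c⟫_ℝ| := by
  simp only [signSum, inner_sum, inner_smul_right]
  exact Finset.sum_congr rfl fun i _ ↦ by rw [real_inner_comm, sgn_mul_self]

lemma inner_le_of_mem_zonotope {s : Finset ι} {a : ι → E} {x : E} (hx : x ∈ zonotope s a)
    (c : E) : ⟪c, x⟫_ℝ ≤ ∑ i ∈ s, |⟪a i, c⟫_ℝ| := by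
  obtain ⟨t, ht, rfl⟩ := mem_zonotope.1 hx
  simp only [inner_sum, inner_smul_right]
  refine Finset.sum_le_sum fun i hi ↦ (le_abs_self _).trans ?_
  rw [abs_mul, real_inner_comm]
  exact mul_le_of_le_one_left (abs_nonneg _) (ht i hi)

/-- The maximum is `∑ |⟪a i, c⟫|`, and each summand is bounded by its own absolute value, so the sum
is maximal only if every summand is. -/
lemma sum_mem_maxFace_iff {s : Finset ι} {a : ι → E} {t : ι → ℝ} (ht : ∀ i ∈ s, |t i| ≤ 1)
    (c : E) : ∑ i ∈ s, t i • a i ∈ maxFace (zonotope s a) c ↔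
      ∀ i ∈ s, t i * ⟪a i, c⟫_ℝ = |⟪a i, c⟫_ℝ| := by
  have hle : ∀ i ∈ s, t i * ⟪a i, c⟫_ℝ ≤ |⟪a i, c⟫_ℝ| := fun i hi ↦ by
    refine (le_abs_self _).trans ?_
    rw [abs_mul]
    exact mul_le_of_le_one_left (abs_nonneg _) (ht i hi)
  have hin : ⟪c, ∑ i ∈ s, t i • a i⟫_ℝ = ∑ i ∈ s, t i * ⟪a i, c⟫_ℝ := by
    simp only [inner_sum, inner_smul_right]
    exact Finset.sum_congr rfl fun i _ ↦ by rw [real_inner_comm]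
  rw [← Finset.sum_eq_sum_iff_of_le hle, ← hin]
  constructor
  · rintro ⟨h1, h2⟩
    refine le_antisymm (inner_le_of_mem_zonotope h1 c) ?_
    rw [← inner_signSum]
    exact h2 _ (signSum_mem_zonotope s a c)
  · intro h
    exact ⟨mem_zonotope.2 ⟨t, ht, rfl⟩, fun y hy ↦ h ▸ inner_le_of_mem_zonotope hy c⟩

lemma signSum_mem_maxFace_iff (s : Finset ι) (a : ι → E) (c d : E) :
    signSum s a c ∈ maxFace (zonotope s a) d ↔ d ∈ cell s a c :=
  sum_mem_maxFace_iff (fun _ _ ↦ abs_sgn_le _) d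

lemma mem_cell_self (s : Finset ι) (a : ι → E) (c : E) : c ∈ cell s a c :=
  fun _ _ ↦ sgn_mul_self _

/-- The sign sum of `c` alone tests membership in the normal cone. Conversely, on the face of `c`
the coefficients with `⟪a i, c⟫ ≠ 0` are forced, and the remaining `a i` are orthogonal to every `d`
in the cell. -/
lemma normalCone_maxFace (s : Finset ι) (a : ι → E) (c : E) :
    normalCone (zonotope s a) (maxFace (zonotope s a) c) = cell s a c := by
  ext d
  constructor
  · intro h
    exact (signSum_mem_maxFace_iff s a c d).1
      (h ((signSum_mem_maxFace_iff s a c c).2 (mem_cell_self s a c)))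
  · intro h x hx
    obtain ⟨t, ht, rfl⟩ := mem_zonotope.1 hx.1
    rw [sum_mem_maxFace_iff ht] at hx ⊢
    intro i hi
    rcases eq_or_ne ⟪a i, c⟫_ℝ 0 with h0 | h0
    · have := h i hi
      rw [h0, sgn_zero, zero_mul] at this
      rw [abs_eq_zero.1 this.symm]
      simp
    · have h1 := hx i hi
      rw [← sgn_mul_self] at h1
      rw [mul_right_cancel₀ h0 h1]
      exact h i hi

lemma normalFan_zonotope (s : Finset ι) (a : ι → E) :
    normalFan (zonotope s a) = Set.range (cell s a) := by
  ext C
  constructor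
  · rintro ⟨F, ⟨-, c, rfl⟩, rfl⟩
    exact ⟨c, (normalCone_maxFace s a c).symm⟩
  · rintro ⟨c, rfl⟩
    exact ⟨_, ⟨⟨_, (signSum_mem_maxFace_iff s a c c).2 (mem_cell_self s a c)⟩, c, rfl⟩,
      normalCone_maxFace s a c⟩

/-! ## Generic vectors and small perturbations -/

/-- By continuity a small step along `g` keeps the finitely many non-zero signs; only the vanishing
products are decided by `g`. -/
lemma exists_pos_forall_sgn_eq (s : Finset ι) (a : ι → E) (c g : E) :
    ∃ ε : ℝ, 0 < ε ∧ ∀ i ∈ s, ⟪a i, c⟫_ℝ ≠ 0 →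
      sgn ⟪a i, c + ε • g⟫_ℝ = sgn ⟪a i, c⟫_ℝ := by
  have key : ∀ i ∈ s, ∀ᶠ ε : ℝ in nhdsWithin 0 (Set.Ioi 0), ⟪a i, c⟫_ℝ ≠ 0 →
      sgn ⟪a i, c + ε • g⟫_ℝ = sgn ⟪a i, c⟫_ℝ := by
    intro i _
    have hc : Filter.Tendsto (fun ε : ℝ ↦ ⟪a i, c + ε • g⟫_ℝ) (nhdsWithin 0 (Set.Ioi 0))
        (nhds ⟪a i, c⟫_ℝ) := by
      have : Continuous fun ε : ℝ ↦ ⟪a i, c + ε • g⟫_ℝ := by fun_prop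
      simpa using (this.tendsto 0).mono_left nhdsWithin_le_nhds
    rcases lt_trichotomy ⟪a i, c⟫_ℝ 0 with h | h | h
    · filter_upwards [hc.eventually (gt_mem_nhds h)] with ε hε _
      rw [sgn_neg h, sgn_neg hε]
    · exact Filter.Eventually.of_forall fun ε h' ↦ absurd h h'
    · filter_upwards [hc.eventually (lt_mem_nhds h)] with ε hε _
      rw [sgn_pos h, sgn_pos hε]
  obtain ⟨ε, h1, h2⟩ := (((Finset.eventually_all s).2 key).and self_mem_nhdsWithin).exists
  exact ⟨ε, h2, h1⟩

lemma exists_isGeneric (s : Finset ι) (a : ι → E) : ∃ c, IsGeneric s a c := by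
  classical
  let T : Set (Submodule ℝ E) := (fun i ↦ (ℝ ∙ a i)ᗮ) '' {i | i ∈ s ∧ a i ≠ 0}
  have hT : T.Finite := (s.finite_toSet.subset fun i hi ↦ hi.1).image _
  have htop : ⊤ ∉ hT.toFinset := by
    rw [Set.Finite.mem_toFinset]
    rintro ⟨i, ⟨-, hi⟩, h⟩
    have : a i ∈ (ℝ ∙ a i)ᗮ := by simp only at h; rw [h]; trivial
    rw [Submodule.mem_orthogonal_singleton_iff_inner_right] at this
    exact hi (inner_self_eq_zero.1 this)
  have := Subspace.biUnion_ne_univ_of_top_notMem htop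
  rw [Set.ne_univ_iff_exists_notMem] at this
  obtain ⟨c, hc⟩ := this
  refine ⟨c, fun i hi h0 h ↦ hc ?_⟩
  simp only [Set.mem_iUnion]
  exact ⟨(ℝ ∙ a i)ᗮ, by simpa [T] using ⟨i, ⟨hi, h0⟩, rfl⟩,
    Submodule.mem_orthogonal_singleton_iff_inner_right.2 h⟩

lemma isGeneric_perturb {s : Finset ι} {a : ι → E} {c g : E} {ε : ℝ} (hg : IsGeneric s a g)
    (hε : 0 < ε) (h : ∀ i ∈ s, ⟪a i, c⟫_ℝ ≠ 0 → sgn ⟪a i, c + ε • g⟫_ℝ = sgn ⟪a i, c⟫_ℝ) :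
    IsGeneric s a (c + ε • g) := by
  intro i hi hai h0
  rcases eq_or_ne ⟪a i, c⟫_ℝ 0 with hc | hc
  · rw [inner_add_right, hc, zero_add, inner_smul_right] at h0
    exact (mul_ne_zero hε.ne' (hg i hi hai)) h0
  · have h1 := h i hi hc
    rw [h0, sgn_zero] at h1
    have h2 := sgn_mul_sgn hc
    rw [← h1] at h2
    simp at h2

/-! ## The normal fan of a zonotope is an arrangement fan -/

lemma notMem_hyperplanes_iff {s : Finset ι} {a : ι → E} {c : E} :
    (∀ H ∈ hyperplanes s a, c ∉ H) ↔ IsGeneric s a c := by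
  constructor
  · intro h i hi hai h0
    exact h _ ⟨i, hi, hai, rfl⟩ (Submodule.mem_orthogonal_singleton_iff_inner_right.2 h0)
  · rintro h H ⟨i, hi, hai, rfl⟩ hc
    exact h i hi hai (Submodule.mem_orthogonal_singleton_iff_inner_right.1 hc)

lemma isArrangement_hyperplanes (s : Finset ι) (a : ι → E) :
    IsArrangement (hyperplanes s a) := by
  constructor
  · refine (s.finite_toSet.image fun i ↦ (ℝ ∙ a i)ᗮ).subset ?_
    rintro H ⟨i, hi, -, rfl⟩
    exact ⟨i, hi, rfl⟩
  · rintro H ⟨i, -, hai, rfl⟩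
    exact ⟨a i, hai, rfl⟩

/-- The orthogonal complement of `(ℝ ∙ a i)ᗮ` is a line, so up to positive scaling its only normal
on the side of `c` is `sgn ⟪a i, c⟫_ℝ • a i`. -/
lemma mem_regionOf_iff {s : Finset ι} {a : ι → E} {c : E} (hc : IsGeneric s a c) {x : E} :
    x ∈ regionOf (hyperplanes s a) c ↔ ∀ i ∈ s, 0 ≤ sgn ⟪a i, c⟫_ℝ * ⟪a i, x⟫_ℝ := by
  constructor
  · intro h i hi
    rcases eq_or_ne (a i) 0 with h0 | h0
    · simp [h0]
    have hz := h _ ⟨i, hi, h0, rfl⟩ (sgn ⟪a i, c⟫_ℝ • a i)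
      (Submodule.le_orthogonal_orthogonal _
        (Submodule.smul_mem _ _ (Submodule.mem_span_singleton_self _)))
    rw [real_inner_smul_left, real_inner_smul_left, sgn_mul_self] at hz
    exact hz (abs_pos.2 (hc i hi h0))
  · rintro h H ⟨i, hi, hai, rfl⟩ z hz hzc
    rw [Submodule.orthogonal_orthogonal] at hz
    obtain ⟨r, rfl⟩ := Submodule.mem_span_singleton.1 hz
    rw [real_inner_smul_left] at hzc ⊢
    have h1 := h i hi
    rcases lt_or_gt_of_ne (hc i hi hai) with h2 | h2
    · rw [sgn_neg h2] at h1
      nlinarith [neg_of_mul_pos_left hzc h2.le]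
    · rw [sgn_pos h2, one_mul] at h1
      exact mul_nonneg (pos_of_mul_pos_left hzc h2.le).le h1

lemma regionOf_eq_cell {s : Finset ι} {a : ι → E} {c : E} (hc : IsGeneric s a c) :
    regionOf (hyperplanes s a) c = cell s a c := by
  ext x
  rw [mem_regionOf_iff hc]
  refine forall₂_congr fun i hi ↦ ?_
  rcases eq_or_ne (a i) 0 with h0 | h0
  · simp [h0]
  · exact (sgn_mul_eq_abs_iff (hc i hi h0)).symm

lemma mem_cell_iff_sgn {s : Finset ι} {a : ι → E} {c x : E} :
    x ∈ cell s a c ↔ ∀ i ∈ s, ⟪a i, x⟫_ℝ ≠ 0 → sgn ⟪a i, c⟫_ℝ = sgn ⟪a i, x⟫_ℝ := by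
  refine forall₂_congr fun i _ ↦ ?_
  rw [← sgn_mul_self]
  constructor
  · exact fun h h0 ↦ mul_right_cancel₀ h0 h
  · intro h
    rcases eq_or_ne ⟪a i, x⟫_ℝ 0 with h0 | h0
    · simp [h0]
    · rw [h h0]

lemma add_mem_cell {s : Finset ι} {a : ι → E} {c x y : E} (hx : x ∈ cell s a c)
    (hy : y ∈ cell s a c) : x + y ∈ cell s a c := by
  intro i hi
  have h1 := hx i hi
  have h2 := hy i hi
  rw [inner_add_right, mul_add, h1, h2]
  rcases eq_or_ne ⟪a i, c⟫_ℝ 0 with h0 | h0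
  · rw [h0, sgn_zero, zero_mul] at h1 h2
    rw [abs_eq_zero.1 h1.symm, abs_eq_zero.1 h2.symm]
    simp
  · rw [← h1, ← h2, ← mul_add]
    refine (sgn_mul_eq_abs_iff h0).2 ?_
    rw [mul_add, h1, h2]
    positivity

lemma zero_mem_cell (s : Finset ι) (a : ι → E) (c : E) : (0 : E) ∈ cell s a c := by
  intro i _
  simp

/-- The cell contains 0 and is closed under addition: adding any point to a maximizer cannot
increase the value, so the maximum is 0. -/
lemma maxFace_cell_of_nonempty {s : Finset ι} {a : ι → E} {c d : E}
    (h : (maxFace (cell s a c) d).Nonempty) :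
    (∀ x ∈ cell s a c, ⟪d, x⟫_ℝ ≤ 0) ∧
      maxFace (cell s a c) d = {x | x ∈ cell s a c ∧ ⟪d, x⟫_ℝ = 0} := by
  obtain ⟨x, hx, hmax⟩ := h
  have hx0 : 0 ≤ ⟪d, x⟫_ℝ := by simpa using hmax 0 (zero_mem_cell s a c)
  have hle : ∀ y ∈ cell s a c, ⟪d, y⟫_ℝ ≤ 0 := by
    intro y hy
    have := hmax _ (add_mem_cell hx hy)
    rw [inner_add_right] at this
    linarith
  refine ⟨hle, Set.ext fun y ↦ ⟨fun hy ↦ ⟨hy.1, le_antisymm (hle y hy.1) ?_⟩, fun hy ↦ ⟨hy.1, ?_⟩⟩⟩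
  · simpa using hy.2 0 (zero_mem_cell s a c)
  · intro z hz
    rw [hy.2]
    exact hle z hz

lemma cell_mem_arrangementFan (s : Finset ι) (a : ι → E) (c : E) :
    cell s a c ∈ arrangementFan (hyperplanes s a) := by
  classical
  obtain ⟨g, hg⟩ := exists_isGeneric s a
  obtain ⟨ε, hε, hs⟩ := exists_pos_forall_sgn_eq s a c g
  set b := c + ε • g
  have hb : IsGeneric s a b := isGeneric_perturb hg hε hs
  have hsub : cell s a c ⊆ cell s a b := by
    intro x hx i hi
    have hxi := hx i hi
    rcases eq_or_ne ⟪a i, c⟫_ℝ 0 with h0 | h0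
    · rw [h0, sgn_zero, zero_mul] at hxi
      rw [abs_eq_zero.1 hxi.symm]
      simp
    · rw [hs i hi h0, hxi]
  -- On the cell of `b` this functional is minus the sum of the `|⟪a i, x⟫|` over those `i` that
  -- vanish at `c`; its zero set there is the cell of `c`.
  refine ⟨_, ⟨b, notMem_hyperplanes_iff.2 hb, rfl⟩, ⟨c, mem_cell_self s a c⟩,
    -∑ i ∈ s with ⟪a i, c⟫_ℝ = 0, sgn ⟪a i, b⟫_ℝ • a i, ?_⟩
  rw [regionOf_eq_cell hb]
  have hin (x : E) (hx : x ∈ cell s a b) :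
      ⟪-∑ i ∈ s with ⟪a i, c⟫_ℝ = 0, sgn ⟪a i, b⟫_ℝ • a i, x⟫_ℝ =
        -∑ i ∈ s with ⟪a i, c⟫_ℝ = 0, |⟪a i, x⟫_ℝ| := by
    rw [inner_neg_left, sum_inner]
    congr 1
    refine Finset.sum_congr rfl fun i hi ↦ ?_
    rw [real_inner_smul_left, hx i (Finset.mem_filter.1 hi).1]
  have hz (x : E) (hx : x ∈ cell s a c) :
      -∑ i ∈ s with ⟪a i, c⟫_ℝ = 0, |⟪a i, x⟫_ℝ| = 0 := by
    rw [neg_eq_zero]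
    refine Finset.sum_eq_zero fun i hi ↦ ?_
    rw [Finset.mem_filter] at hi
    rw [← hx i hi.1, hi.2, sgn_zero, zero_mul]
  ext x
  constructor
  · intro hx
    refine ⟨hsub hx, fun y hy ↦ ?_⟩
    rw [hin y hy, hin x (hsub hx), hz x hx, neg_nonpos]
    exact Finset.sum_nonneg fun i _ ↦ abs_nonneg _
  · rintro ⟨hx, hmax⟩ i hi
    have h1 := hmax c (hsub (mem_cell_self s a c))
    rw [hin x hx, hin c (hsub (mem_cell_self s a c)), hz c (mem_cell_self s a c)] at h1
    rcases eq_or_ne ⟪a i, c⟫_ℝ 0 with h0 | h0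
    · have h2 : ∑ i ∈ s with ⟪a i, c⟫_ℝ = 0, |⟪a i, x⟫_ℝ| = 0 :=
        le_antisymm (by linarith) (Finset.sum_nonneg fun i _ ↦ abs_nonneg _)
      rw [Finset.sum_eq_zero_iff_of_nonneg fun i _ ↦ abs_nonneg _] at h2
      rw [h2 i (Finset.mem_filter.2 ⟨hi, h0⟩), h0]
      simp
    · rw [← hs i hi h0]
      exact hx i hi

/-- The witness is a relative interior point of the face: a sum of points `x i`, each with `⟪a i, x
i⟫ ≠ 0` whenever the face allows it, and 0 otherwise. -/
lemma exists_cell_eq_maxFace_cell {s : Finset ι} {a : ι → E} {c d : E}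
    (h : (maxFace (cell s a c) d).Nonempty) : ∃ b, cell s a b = maxFace (cell s a c) d := by
  classical
  obtain ⟨hle, hF⟩ := maxFace_cell_of_nonempty h
  rw [hF]
  clear hF h
  set F := {x | x ∈ cell s a c ∧ ⟪d, x⟫_ℝ = 0} with hFdef
  have hex : ∀ i, ∃ x ∈ F, (⟪a i, x⟫_ℝ = 0 → ∀ y ∈ F, ⟪a i, y⟫_ℝ = 0) := by
    intro i
    by_cases h : ∃ x ∈ F, ⟪a i, x⟫_ℝ ≠ 0
    · obtain ⟨x, hx, hx0⟩ := h
      exact ⟨x, hx, fun h0 ↦ absurd h0 hx0⟩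
    · push Not at h
      exact ⟨0, ⟨zero_mem_cell s a c, by simp⟩, fun _ ↦ h⟩
  choose x hxF hx using hex
  have hsum : ∀ T : Finset ι, ∑ j ∈ T, x j ∈ F := by
    intro T
    refine Finset.sum_induction x (· ∈ F) (fun u v hu hv ↦ ⟨add_mem_cell hu.1 hv.1, ?_⟩)
      ⟨zero_mem_cell s a c, by simp⟩ fun j _ ↦ hxF j
    rw [inner_add_right, hu.2, hv.2, add_zero]
  set b := ∑ j ∈ s, x j
  have hb : b ∈ F := hsum s
  have hb0 : ∀ i ∈ s, ⟪a i, b⟫_ℝ = 0 → ∀ y ∈ F, ⟪a i, y⟫_ℝ = 0 := by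
    intro i hi h0
    refine hx i ?_
    -- Within one cell the values `⟪a i, x j⟫` never have opposite signs, so no cancellation can
    -- occur in `⟪a i, b⟫`.
    have h1 : ∑ j ∈ s, |⟪a i, x j⟫_ℝ| = 0 := by
      rw [← Finset.sum_congr rfl fun j _ ↦ (hxF j).1 i hi, ← Finset.mul_sum, ← inner_sum]
      exact h0.symm ▸ mul_zero _
    rw [Finset.sum_eq_zero_iff_of_nonneg fun j _ ↦ abs_nonneg _] at h1
    exact abs_eq_zero.1 (h1 i hi)
  have hsgn := mem_cell_iff_sgn.1 hb.1
  refine ⟨b, Set.ext fun y ↦ ⟨fun hy ↦ ?_, fun hy i hi ↦ ?_⟩⟩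
  · have hyc : y ∈ cell s a c := by
      intro i hi
      have hyi := hy i hi
      rcases eq_or_ne ⟪a i, b⟫_ℝ 0 with h0 | h0
      · rw [h0, sgn_zero, zero_mul] at hyi
        rw [abs_eq_zero.1 hyi.symm]
        simp
      · rw [hsgn i hi h0, hyi]
    refine ⟨hyc, le_antisymm (hle y hyc) ?_⟩
    -- Moving from `b` slightly away from `y` stays in the cell of `c`, which forces `⟪d, y⟫ ≥ 0`.
    obtain ⟨ε, hε, hs⟩ := exists_pos_forall_sgn_eq s a b (-y)
    have hmem : b + ε • (-y) ∈ cell s a c := by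
      rw [mem_cell_iff_sgn]
      intro i hi hne
      rcases eq_or_ne ⟪a i, b⟫_ℝ 0 with h0 | h0
      · have hyi := hy i hi
        rw [h0, sgn_zero, zero_mul] at hyi
        rw [inner_add_right, inner_smul_right, inner_neg_right, abs_eq_zero.1 hyi.symm, h0] at hne
        simp at hne
      · rw [hs i hi h0, hsgn i hi h0]
    have h1 := hle _ hmem
    rw [inner_add_right, hb.2, inner_smul_right, inner_neg_right] at h1
    nlinarith
  · rcases eq_or_ne ⟪a i, b⟫_ℝ 0 with h0 | h0
    · rw [hb0 i hi h0 y hy]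
      simp
    · rw [← hsgn i hi h0]
      exact hy.1 i hi

lemma arrangementFan_hyperplanes (s : Finset ι) (a : ι → E) :
    arrangementFan (hyperplanes s a) = Set.range (cell s a) := by
  ext C
  constructor
  · rintro ⟨R, ⟨c, hc, rfl⟩, hne, d, rfl⟩
    rw [regionOf_eq_cell (notMem_hyperplanes_iff.1 hc)] at hne ⊢
    exact exists_cell_eq_maxFace_cell hne
  · rintro ⟨c, rfl⟩
    exact cell_mem_arrangementFan s a c

theorem normalFan_zonotope_eq_arrangementFan (s : Finset ι) (a : ι → E) :
    normalFan (zonotope s a) = arrangementFan (hyperplanes s a) := by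
  rw [normalFan_zonotope, arrangementFan_hyperplanes]

/-! ## The vertices of a zonotope -/

lemma finite_range_signSum (s : Finset ι) (a : ι → E) : (Set.range (signSum s a)).Finite := by
  classical
  have : Set.range (signSum s a) ⊆
      Set.range fun σ : s → SignType ↦ ∑ i : s, (σ i : ℝ) • a i := by
    rintro _ ⟨c, rfl⟩
    refine ⟨fun i ↦ SignType.sign ⟪a i, c⟫_ℝ, ?_⟩
    exact Finset.sum_coe_sort s fun i ↦ sgn ⟪a i, c⟫_ℝ • a i
  exact (Set.finite_range _).subset this

/-- A point outside the hull is strictly separated by some `d`. Making `d` generic without losing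
the separation contradicts the maximality of its sign sum. -/
lemma zonotope_eq_convexHull [FiniteDimensional ℝ E] (s : Finset ι) (a : ι → E) :
    zonotope s a = convexHull ℝ (signSum s a '' {c | IsGeneric s a c}) := by
  classical
  have hfin : (signSum s a '' {c | IsGeneric s a c}).Finite :=
    (finite_range_signSum s a).subset (Set.image_subset_range _ _)
  refine Set.Subset.antisymm (fun z hz ↦ ?_)
    (convexHull_min ?_ (convex_zonotope s a))
  · by_contra hzV
    obtain ⟨f, u, hfu, huz⟩ := geometric_hahn_banach_closed_point (convex_convexHull ℝ _)
      (Set.Finite.isClosed_convexHull ℝ hfin) hzV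
    obtain ⟨d, rfl⟩ := (InnerProductSpace.toDual ℝ E).surjective f
    simp only [InnerProductSpace.toDual_apply_apply] at hfu huz
    obtain ⟨g, hg⟩ := exists_isGeneric s a
    have hpert := fun v : hfin.toFinset ↦ sub_pos.2 <| (hfu v (subset_convexHull ℝ _
      (hfin.mem_toFinset.1 v.2))).trans huz
    let s' := hfin.toFinset
    -- Adjoining the vectors `z - v` to the family lets a single `ε` preserve both the signs of the
    -- `a i` and the strict separation.
    obtain ⟨ε, hε, hs⟩ := exists_pos_forall_sgn_eq (s.disjSum s')
      (Sum.elim a fun v ↦ z - v) d g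
    have hgen : IsGeneric s a (d + ε • g) := isGeneric_perturb hg hε fun i hi h0 ↦
      hs (Sum.inl i) (Finset.inl_mem_disjSum.2 hi) h0
    have hv : signSum s a (d + ε • g) ∈ s' := hfin.mem_toFinset.2 ⟨_, hgen, rfl⟩
    have h1 := hpert ⟨_, hv⟩
    have h2 : 0 < ⟪z - signSum s a (d + ε • g), d⟫_ℝ := by
      rw [inner_sub_left, real_inner_comm, real_inner_comm d]
      exact h1
    have h3 := hs (Sum.inr _) (Finset.inr_mem_disjSum.2 hv) h2.ne'
    simp only [Sum.elim_inr] at h3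
    rw [sgn_pos h2] at h3
    have h4 := inner_le_of_mem_zonotope hz (d + ε • g)
    rw [← inner_signSum] at h4
    have h5 : ⟪z - signSum s a (d + ε • g), d + ε • g⟫_ℝ ≤ 0 := by
      rw [inner_sub_left, real_inner_comm, real_inner_comm (d + ε • g)]
      linarith
    rcases h5.lt_or_eq with h6 | h6
    · rw [sgn_neg h6] at h3
      norm_num at h3
    · rw [h6, sgn_zero] at h3
      norm_num at h3
  · rintro _ ⟨c, -, rfl⟩
    exact signSum_mem_zonotope s a c

lemma eq_signSum_of_mem_maxFace {s : Finset ι} {a : ι → E} {c x : E} (hc : IsGeneric s a c)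
    (hx : x ∈ maxFace (zonotope s a) c) : x = signSum s a c := by
  obtain ⟨t, ht, rfl⟩ := mem_zonotope.1 hx.1
  rw [sum_mem_maxFace_iff ht] at hx
  refine Finset.sum_congr rfl fun i hi ↦ ?_
  rcases eq_or_ne (a i) 0 with h0 | h0
  · simp [h0]
  · have := hx i hi
    rw [← sgn_mul_self] at this
    rw [mul_right_cancel₀ (hc i hi h0) this]

/-- A generic functional has a unique maximizer, which is therefore extreme; the other inclusion
comes from the convex hull description. -/
theorem vertices_zonotope [FiniteDimensional ℝ E] (s : Finset ι) (a : ι → E) :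
    vertices (zonotope s a) = signSum s a '' {c | IsGeneric s a c} := by
  refine Set.Subset.antisymm ?_ ?_
  · rw [vertices, zonotope_eq_convexHull]
    exact extremePoints_convexHull_subset (𝕜 := ℝ)
  · rintro _ ⟨c, hc, rfl⟩
    have hmax := (signSum_mem_maxFace_iff s a c c).2 (mem_cell_self s a c)
    refine (mem_extremePoints_iff_left (𝕜 := ℝ)).2 ⟨hmax.1, fun x hx y hy ⟨p, q, hp, hq, hpq, hxy⟩ ↦ ?_⟩
    refine eq_signSum_of_mem_maxFace hc ⟨hx, fun z hz ↦ (hmax.2 z hz).trans ?_⟩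
    have h1 := hmax.2 y hy
    have h2 := congrArg (fun v ↦ ⟪c, v⟫_ℝ) hxy
    simp only [inner_add_right, inner_smul_right] at h2
    have hp' : p = 1 - q := by linarith
    subst hp'
    nlinarith

lemma isPolytope_zonotope [FiniteDimensional ℝ E] (s : Finset ι) (a : ι → E) :
    IsPolytope (zonotope s a) := by
  obtain ⟨g, hg⟩ := exists_isGeneric s a
  exact ⟨_, (finite_range_signSum s a).subset (Set.image_subset_range _ _),
    ⟨_, g, hg, rfl⟩, zonotope_eq_convexHull s a⟩

theorem isInscribed_zonotope [FiniteDimensional ℝ E] {s : Finset ι} {a : ι → E}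
    (h : ∀ c c', IsGeneric s a c → IsGeneric s a c' → ‖signSum s a c‖ = ‖signSum s a c'‖) :
    IsInscribed (zonotope s a) := by
  refine ⟨isPolytope_zonotope s a, ?_⟩
  obtain ⟨g, hg⟩ := exists_isGeneric s a
  refine ⟨0, ‖signSum s a g‖, ?_⟩
  rw [vertices_zonotope]
  rintro _ ⟨c, hc, rfl⟩
  rw [dist_zero_right]
  exact h c g hc hg

theorem stronglyInscribable_hyperplanes [FiniteDimensional ℝ E] {s : Finset ι} {a : ι → E}
    (h : ∀ c c', IsGeneric s a c → IsGeneric s a c' → ‖signSum s a c‖ = ‖signSum s a c'‖) :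
    StronglyInscribable (hyperplanes s a) :=
  ⟨isArrangement_hyperplanes s a, zonotope s a, isZonotope_zonotope s a, isInscribed_zonotope h,
    normalFan_zonotope_eq_arrangementFan s a⟩

end Zonotope

/-! ## Reflections and root systems -/

section Reflection

variable {E : Type*} [NormedAddCommGroup E] [InnerProductSpace ℝ E]

lemma refl_apply (α x : E) : refl α x = x - (2 * ⟪α, x⟫_ℝ / ‖α‖ ^ 2) • α := by
  rw [refl, Submodule.reflection_orthogonal_apply, Submodule.reflection_singleton_apply]
  simp only [RCLike.ofReal_real_eq_id, id_eq]
  module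

lemma refl_refl (α x : E) : refl α (refl α x) = x :=
  Submodule.reflection_reflection _ x

lemma refl_self (α : E) : refl α α = -α :=
  Submodule.reflection_orthogonalComplement_singleton_eq_neg α

lemma inner_refl_left (α x y : E) : ⟪refl α x, y⟫_ℝ = ⟪x, refl α y⟫_ℝ := by
  rw [← (refl α).inner_map_map x, refl_refl]

lemma refl_smul (α : E) {r : ℝ} (hr : r ≠ 0) : refl (r • α) = refl α := by
  have : (ℝ ∙ (r • α) : Submodule ℝ E) = ℝ ∙ α :=
    Submodule.span_singleton_smul_eq (isUnit_iff_ne_zero.2 hr) α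
  simp only [refl, this]

lemma refl_neg (α : E) : refl (-α) = refl α := by
  rw [← neg_one_smul ℝ α, refl_smul α (by norm_num)]

lemma refl_map (w : E ≃ₗᵢ[ℝ] E) (α : E) : refl (w α) = w * refl α * w⁻¹ := by
  ext x
  have h : ⟪w α, x⟫_ℝ = ⟪α, w⁻¹ x⟫_ℝ := by
    rw [← w.inner_map_map α (w⁻¹ x)]
    exact congrArg _ (w.apply_symm_apply x).symm
  have h2 : w (w⁻¹ x) = x := w.apply_symm_apply x
  simp only [LinearIsometryEquiv.coe_mul, Function.comp_apply]
  rw [refl_apply, refl_apply, map_sub, map_smul, h, h2, w.norm_map]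

lemma refl_eq_self_iff (α x : E) : refl α x = x ↔ x ∈ (ℝ ∙ α)ᗮ :=
  Submodule.reflection_eq_self_iff x

lemma mem_span_singleton_of_refl_eq_neg {α β : E} (h : refl α β = -β) :
    β ∈ (ℝ ∙ α : Submodule ℝ E) := by
  rw [refl_apply] at h
  refine Submodule.mem_span_singleton.2 ⟨⟪α, β⟫_ℝ / ‖α‖ ^ 2, ?_⟩
  have : (2 : ℝ) • ((⟪α, β⟫_ℝ / ‖α‖ ^ 2) • α) = (2 : ℝ) • β := by
    rw [sub_eq_iff_eq_add, ← sub_eq_iff_eq_add'] at h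
    rw [two_smul ℝ β, smul_smul, ← mul_div_assoc, ← h]
    abel
  exact smul_right_injective E (two_ne_zero (α := ℝ)) this

lemma det_refl [FiniteDimensional ℝ E] {α : E} (hα : α ≠ 0) :
    LinearMap.det (refl α).toLinearEquiv.toLinearMap = -1 := by
  have := Submodule.det_reflection (ℝ ∙ α)ᗮ
  rw [Submodule.orthogonal_orthogonal, finrank_span_singleton hα, pow_one] at this
  exact this

end Reflection

section RootSystem

variable {E : Type*} [NormedAddCommGroup E] [InnerProductSpace ℝ E]
  {W : Subgroup (E ≃ₗᵢ[ℝ] E)} {Φ : Finset E}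

lemma IsRootSystem.eq_or_eq_neg (h : IsRootSystem Φ) {α β : E} (hα : α ∈ Φ) (hβ : β ∈ Φ)
    (hαβ : β ∈ (ℝ ∙ α : Submodule ℝ E)) : β = -α ∨ β = α := by
  have : β ∈ (Φ : Set E) ∩ ((ℝ ∙ α : Submodule ℝ E) : Set E) := ⟨hβ, hαβ⟩
  rw [h.inter_line α hα] at this
  exact this

lemma IsRootSystem.neg_mem (h : IsRootSystem Φ) {α : E} (hα : α ∈ Φ) : -α ∈ Φ := by
  have : -α ∈ ({-α, α} : Set E) := by simp
  rw [← h.inter_line α hα] at this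
  exact this.1

lemma IsRootSystem.refl_mem (h : IsRootSystem Φ) {α β : E} (hα : α ∈ Φ) (hβ : β ∈ Φ) :
    refl α β ∈ Φ := by
  have : refl α β ∈ refl α '' (Φ : Set E) := ⟨β, hβ, rfl⟩
  rwa [h.image_refl α hα] at this

lemma IsRootSystemOf.refl_mem (h : IsRootSystemOf Φ W) {α : E} (hα : α ∈ Φ) : refl α ∈ W :=
  h.2 ▸ Subgroup.subset_closure ⟨α, hα, rfl⟩

lemma IsRootSystemOf.map_mem_iff (h : IsRootSystemOf Φ W) {w : E ≃ₗᵢ[ℝ] E} (hw : w ∈ W) :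
    ∀ x, w x ∈ Φ ↔ x ∈ Φ := by
  rw [← h.2] at hw
  induction hw using Subgroup.closure_induction with
  | mem w hw =>
    obtain ⟨α, hα, rfl⟩ := hw
    refine fun x ↦ ⟨fun hx ↦ ?_, h.1.refl_mem hα⟩
    rw [← refl_refl α x]
    exact h.1.refl_mem hα hx
  | one => exact fun x ↦ Iff.rfl
  | mul u v _ _ hu hv => exact fun x ↦ (hu (v x)).trans (hv x)
  | inv u _ hu =>
    intro x
    rw [← hu (u⁻¹ x)]
    exact iff_of_eq (congrArg (· ∈ Φ) (u.apply_symm_apply x))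

lemma IsRootSystemOf.map_signSum (h : IsRootSystemOf Φ W) {w : E ≃ₗᵢ[ℝ] E} (hw : w ∈ W) (c : E) :
    w (signSum Φ id c) = signSum Φ id (w c) := by
  simp only [signSum, map_sum, map_smul, id]
  refine Finset.sum_nbij' w w.symm (fun γ hγ ↦ (h.map_mem_iff hw γ).2 hγ) (fun γ hγ ↦ ?_)
    (fun γ _ ↦ w.symm_apply_apply γ) (fun γ _ ↦ w.apply_symm_apply γ) (fun γ _ ↦ ?_)
  · rw [← h.map_mem_iff hw, w.apply_symm_apply]
    exact hγ
  · rw [w.inner_map_map]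

lemma IsRootSystemOf.isGeneric_map (h : IsRootSystemOf Φ W) {w : E ≃ₗᵢ[ℝ] E} (hw : w ∈ W) {c : E}
    (hc : IsGeneric Φ id c) : IsGeneric Φ id (w c) := by
  intro γ hγ h0
  have h1 : w (w.symm γ) = γ := w.apply_symm_apply γ
  have h2 : w.symm γ ∈ Φ := by rwa [← h.map_mem_iff hw, h1]
  have := hc _ h2 (h.1.ne_zero _ h2)
  rwa [id, ← w.inner_map_map, h1] at this

lemma sgn_eq_sgn_of_mul_nonneg {x y : ℝ} (hx : x ≠ 0) (hy : y ≠ 0) (h : 0 ≤ x * y) :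
    sgn x = sgn y := by
  rcases lt_or_gt_of_ne hx with hx | hx <;> rcases lt_or_gt_of_ne hy with hy | hy
  · rw [sgn_neg hx, sgn_neg hy]
  · nlinarith [mul_pos_of_neg_of_neg hx (neg_neg_of_pos hy)]
  · nlinarith [mul_pos hx (neg_pos.2 hy)]
  · rw [sgn_pos hx, sgn_pos hy]

/-- A finite reflection group acts transitively on the chambers of a root system. -/
lemma IsRootSystemOf.exists_signSum_eq [Finite W] (h : IsRootSystemOf Φ W) {c c' : E}
    (hc : IsGeneric Φ id c) (hc' : IsGeneric Φ id c') :
    ∃ w ∈ W, signSum Φ id c = w (signSum Φ id c') := by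
  -- Take `w c'` as close to `c` as possible. Comparing with `refl α * w` gives `⟪α, c⟫ * ⟪α, w c'⟫
  -- ≥ 0` for every root, so `c` and `w c'` have the same signs.
  obtain ⟨⟨w, hw⟩, hmax⟩ := Finite.exists_max fun w : W ↦ ⟪c, (w : E ≃ₗᵢ[ℝ] E) c'⟫_ℝ
  refine ⟨w, hw, ?_⟩
  rw [h.map_signSum hw]
  refine Finset.sum_congr rfl fun α hα ↦ ?_
  have hα0 := h.1.ne_zero α hα
  have hn : 0 < ‖α‖ ^ 2 := by positivity
  rw [sgn_eq_sgn_of_mul_nonneg (hc α hα hα0) (h.isGeneric_map hw hc' α hα hα0)]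
  have h1 : ⟪c, refl α (w c')⟫_ℝ ≤ ⟪c, w c'⟫_ℝ := hmax ⟨refl α * w, W.mul_mem (h.refl_mem hα) hw⟩
  rw [refl_apply, inner_sub_right, inner_smul_right, real_inner_comm α c] at h1
  have h2 : 0 ≤ 2 * ⟪α, w c'⟫_ℝ * ⟪α, c⟫_ℝ / ‖α‖ ^ 2 := by
    rw [mul_div_right_comm]
    linarith
  rw [le_div_iff₀ hn, zero_mul] at h2
  simp only [id]
  linarith

lemma IsRootSystemOf.norm_signSum_eq [Finite W] (h : IsRootSystemOf Φ W) {c c' : E}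
    (hc : IsGeneric Φ id c) (hc' : IsGeneric Φ id c') :
    ‖signSum Φ id c‖ = ‖signSum Φ id c'‖ := by
  obtain ⟨w, -, hw⟩ := h.exists_signSum_eq hc hc'
  rw [hw, w.norm_map]

/-! ## The reflections in a finite reflection group -/

/-- Up to the sign `f`, the reflection permutes the positive roots other than `α`. Simplicity of `α`
is not needed: the sign changes come in pairs. -/
lemma IsRootSystem.prod_erase_refl [DecidableEq E] (h : IsRootSystem Φ) {g α : E}
    (hg : IsGeneric Φ id g) (hα : α ∈ Φ) (hαg : 0 < ⟪α, g⟫_ℝ) (x : E) :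
    ∏ γ ∈ {γ ∈ Φ | 0 < ⟪γ, g⟫_ℝ}.erase α, ⟪γ, refl α x⟫_ℝ =
      ∏ γ ∈ {γ ∈ Φ | 0 < ⟪γ, g⟫_ℝ}.erase α, ⟪γ, x⟫_ℝ := by
  set P := {γ ∈ Φ | 0 < ⟪γ, g⟫_ℝ}.erase α with hP
  have hPmem {γ : E} : γ ∈ P ↔ γ ≠ α ∧ γ ∈ Φ ∧ 0 < ⟪γ, g⟫_ℝ := by
    rw [hP, Finset.mem_erase, Finset.mem_filter]
  have hspan {γ : E} (hγ : γ ∈ P) : γ ∉ (ℝ ∙ α : Submodule ℝ E) := by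
    intro hs
    rw [hPmem] at hγ
    rcases h.eq_or_eq_neg hα hγ.2.1 hs with rfl | rfl
    · rw [inner_neg_left] at hγ
      linarith [hγ.2.2]
    · exact hγ.1 rfl
  set f : E → ℝ := fun γ ↦ sgn ⟪refl α γ, g⟫_ℝ
  set φ : E → E := fun γ ↦ f γ • refl α γ
  have hf {γ : E} (hγ : γ ∈ P) : (f γ = 1 ∧ 0 < ⟪refl α γ, g⟫_ℝ) ∨
      (f γ = -1 ∧ ⟪refl α γ, g⟫_ℝ < 0) := by
    have hγ' := h.refl_mem hα (hPmem.1 hγ).2.1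
    rcases lt_or_gt_of_ne (hg _ hγ' (h.ne_zero _ hγ')) with h1 | h1
    · exact Or.inr ⟨sgn_neg h1, h1⟩
    · exact Or.inl ⟨sgn_pos h1, h1⟩
  have hφP {γ : E} (hγ : γ ∈ P) : φ γ ∈ P := by
    have hγ' := h.refl_mem hα (hPmem.1 hγ).2.1
    have hne : refl α γ ∉ (ℝ ∙ α : Submodule ℝ E) := by
      intro hs
      obtain ⟨r, hr⟩ := Submodule.mem_span_singleton.1 hs
      refine hspan hγ (Submodule.mem_span_singleton.2 ⟨-r, ?_⟩)
      rw [← refl_refl α γ, ← hr, map_smul, refl_self, smul_neg, neg_smul]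
    rw [hPmem]
    simp only [φ]
    rcases hf hγ with ⟨h1, h2⟩ | ⟨h1, h2⟩
    · rw [h1, one_smul]
      exact ⟨fun h3 ↦ hne (by rw [h3]; exact Submodule.mem_span_singleton_self α), hγ', h2⟩
    · rw [h1, neg_one_smul]
      refine ⟨fun h3 ↦ hne ?_, h.neg_mem hγ', by rw [inner_neg_left]; linarith⟩
      rw [← neg_neg (refl α γ), h3]
      exact Submodule.neg_mem _ (Submodule.mem_span_singleton_self α)
  have hfφ {γ : E} (hγ : γ ∈ P) : f (φ γ) = f γ := by
    have hpos := (hPmem.1 hγ).2.2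
    have h3 : f (φ γ) = sgn (f γ * ⟪γ, g⟫_ℝ) := by
      simp only [f, φ]
      rw [map_smul, refl_refl, real_inner_smul_left]
    rw [h3]
    rcases hf hγ with ⟨h1, -⟩ | ⟨h1, -⟩
    · rw [h1, one_mul, sgn_pos hpos]
    · rw [h1, sgn_neg (by linarith)]
  have hff {γ : E} (hγ : γ ∈ P) : f γ * f γ = 1 := by
    rcases hf hγ with ⟨h1, -⟩ | ⟨h1, -⟩ <;> rw [h1] <;> norm_num
  have hφφ {γ : E} (hγ : γ ∈ P) : φ (φ γ) = γ := by
    change f (φ γ) • refl α (f γ • refl α γ) = γ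
    rw [hfφ hγ, map_smul, refl_refl, smul_smul, hff hγ, one_smul]
  -- The involution `φ` preserves `f`, so two-element orbits contribute 1. A fixed point with sign
  -- -1 would satisfy `refl α γ = -γ` and lie on the line of `α`.
  have h1 : ∏ γ ∈ P, f γ = 1 := by
    refine Finset.prod_involution (fun γ _ ↦ φ γ) (fun γ hγ ↦ by rw [hfφ hγ, hff hγ])
      (fun γ hγ hne heq ↦ ?_) (fun γ hγ ↦ hφP hγ) (fun γ hγ ↦ hφφ hγ)
    rcases hf hγ with ⟨h1, -⟩ | ⟨h1, -⟩
    · exact hne h1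
    · refine hspan hγ (mem_span_singleton_of_refl_eq_neg ?_)
      simp only [φ, h1, neg_one_smul] at heq
      rw [← neg_neg (refl α γ), heq]
  have h2 : ∏ γ ∈ P, ⟪φ γ, x⟫_ℝ = ∏ γ ∈ P, ⟪γ, x⟫_ℝ :=
    Finset.prod_nbij' φ φ (fun γ hγ ↦ hφP hγ) (fun γ hγ ↦ hφP hγ) (fun γ hγ ↦ hφφ hγ)
      (fun γ hγ ↦ hφφ hγ) fun γ _ ↦ rfl
  rw [← h2, ← one_mul (∏ γ ∈ P, ⟪φ γ, x⟫_ℝ), ← h1, ← Finset.prod_mul_distrib]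
  refine Finset.prod_congr rfl fun γ hγ ↦ ?_
  rw [real_inner_smul_left, ← mul_assoc, hff hγ, one_mul, inner_refl_left]

/-- The product of the positive roots changes its sign under each root reflection. -/
lemma IsRootSystem.prod_refl (h : IsRootSystem Φ) {g α : E}
    (hg : IsGeneric Φ id g) (hα : α ∈ Φ) (x : E) :
    ∏ γ ∈ Φ with 0 < ⟪γ, g⟫_ℝ, ⟪γ, refl α x⟫_ℝ = -∏ γ ∈ Φ with 0 < ⟪γ, g⟫_ℝ, ⟪γ, x⟫_ℝ := by
  classical
  wlog hαg : 0 < ⟪α, g⟫_ℝ generalizing α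
  · have h1 := (not_lt.1 hαg).lt_of_ne (hg α hα (h.ne_zero α hα))
    rw [← refl_neg]
    exact this (h.neg_mem hα) (by rw [inner_neg_left]; linarith)
  have hmem : α ∈ {γ ∈ Φ | 0 < ⟪γ, g⟫_ℝ} := Finset.mem_filter.2 ⟨hα, hαg⟩
  rw [← Finset.mul_prod_erase _ _ hmem, ← Finset.mul_prod_erase _ _ hmem,
    h.prod_erase_refl hg hα hαg, ← inner_refl_left, refl_self, inner_neg_left, neg_mul]

lemma IsRootSystemOf.prod_map [FiniteDimensional ℝ E] (h : IsRootSystemOf Φ W) {g : E}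
    (hg : IsGeneric Φ id g) {w : E ≃ₗᵢ[ℝ] E} (hw : w ∈ W) :
    ∀ x, ∏ γ ∈ Φ with 0 < ⟪γ, g⟫_ℝ, ⟪γ, w x⟫_ℝ =
      LinearMap.det w.toLinearEquiv.toLinearMap * ∏ γ ∈ Φ with 0 < ⟪γ, g⟫_ℝ, ⟪γ, x⟫_ℝ := by
  have hmul (u v : E ≃ₗᵢ[ℝ] E) : LinearMap.det (u * v).toLinearEquiv.toLinearMap =
      LinearMap.det u.toLinearEquiv.toLinearMap * LinearMap.det v.toLinearEquiv.toLinearMap :=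
    LinearMap.det_comp u.toLinearEquiv.toLinearMap v.toLinearEquiv.toLinearMap
  have hone : LinearMap.det (1 : E ≃ₗᵢ[ℝ] E).toLinearEquiv.toLinearMap = 1 :=
    LinearMap.det_id
  rw [← h.2] at hw
  induction hw using Subgroup.closure_induction with
  | mem w hw =>
    obtain ⟨α, hα, rfl⟩ := hw
    intro x
    rw [h.1.prod_refl hg hα, det_refl (h.1.ne_zero α hα), neg_one_mul]
  | one =>
    intro x
    rw [hone, one_mul]
    rfl
  | mul u v _ _ hu hv =>
    intro x
    rw [hmul, mul_assoc, ← hv x]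
    exact hu (v x)
  | inv u _ hu =>
    intro x
    have h1 := hu (u⁻¹ x)
    rw [show u (u⁻¹ x) = x from u.apply_symm_apply x] at h1
    rw [h1, ← mul_assoc, ← hmul, inv_mul_cancel, hone, one_mul]

lemma orthogonal_span_singleton_eq_of_mem {α β : E} (hα : α ≠ 0)
    (h : α ∈ (ℝ ∙ β : Submodule ℝ E)) : (ℝ ∙ β)ᗮ = (ℝ ∙ α)ᗮ := by
  obtain ⟨r, rfl⟩ := Submodule.mem_span_singleton.1 h
  have hr : r ≠ 0 := by
    rintro rfl
    simp at hα
  rw [Submodule.span_singleton_smul_eq (isUnit_iff_ne_zero.2 hr)]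

lemma inner_orthogonalProjectionOnto (L : Submodule ℝ E) [L.HasOrthogonalProjection] (x : E)
    (c : L) : ⟪L.orthogonalProjectionOnto x, c⟫_ℝ = ⟪x, (c : E)⟫_ℝ :=
  Submodule.inner_orthogonalProjectionOnto_eq_of_mem_right c x

lemma orthogonalProjectionOnto_eq_zero_iff' (L : Submodule ℝ E) [L.HasOrthogonalProjection]
    (x : E) : L.orthogonalProjectionOnto x = 0 ↔ ∀ c ∈ L, ⟪x, c⟫_ℝ = 0 := by
  constructor
  · intro h c hc
    have := inner_orthogonalProjectionOnto L x ⟨c, hc⟩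
    rw [h, inner_zero_left] at this
    exact this.symm
  · intro h
    refine ext_inner_right ℝ fun c ↦ ?_
    rw [inner_orthogonalProjectionOnto, inner_zero_left]
    exact h c c.2

/-- Every reflection in the group of a root system is the reflection in a root. -/
theorem IsRootSystemOf.reflectionArrangement_eq [FiniteDimensional ℝ E]
    (h : IsRootSystemOf Φ W) : reflectionArrangement W = hyperplanes Φ id := by
  ext H
  constructor
  · rintro ⟨β, hβ0, hβ, rfl⟩
    by_contra hH
    have hne : ∀ γ ∈ Φ, (ℝ ∙ β)ᗮ.orthogonalProjectionOnto γ ≠ 0 := by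
      intro γ hγ h0
      rw [orthogonalProjectionOnto_eq_zero_iff'] at h0
      have hmem : γ ∈ (ℝ ∙ β)ᗮᗮ := (Submodule.mem_orthogonal' _ _).2 h0
      rw [Submodule.orthogonal_orthogonal] at hmem
      have hγ0 := h.1.ne_zero γ hγ
      exact hH ⟨γ, hγ, hγ0, orthogonal_span_singleton_eq_of_mem hγ0 hmem⟩
    -- As no root projects to zero on `(ℝ ∙ β)ᗮ`, some `c` there is orthogonal to no root. But `refl
    -- β` fixes `c` and has determinant -1, so the product of positive roots vanishes at `c`.
    obtain ⟨c, hc⟩ := exists_isGeneric Φ fun γ ↦ (ℝ ∙ β)ᗮ.orthogonalProjectionOnto γ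
    obtain ⟨g, hg⟩ := exists_isGeneric Φ (id : E → E)
    have h1 := h.prod_map hg hβ (c : E)
    rw [det_refl hβ0, (refl_eq_self_iff β c).2 c.2] at h1
    have h2 : ∏ γ ∈ Φ with 0 < ⟪γ, g⟫_ℝ, ⟪γ, (c : E)⟫_ℝ ≠ 0 := by
      rw [Finset.prod_ne_zero_iff]
      intro γ hγ
      have hγ' := (Finset.mem_filter.1 hγ).1
      rw [← inner_orthogonalProjectionOnto]
      exact hc γ hγ' (hne γ hγ')
    exact h2 (by linarith)
  · rintro ⟨α, hα, hα0, rfl⟩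
    exact ⟨α, hα0, h.refl_mem hα, rfl⟩

/-! ## Existence of a root system -/

lemma eq_or_eq_neg_of_norm_eq_one {α β : E} (hα : ‖α‖ = 1) (hβ : ‖β‖ = 1)
    (h : β ∈ (ℝ ∙ α : Submodule ℝ E)) : β = -α ∨ β = α := by
  obtain ⟨r, rfl⟩ := Submodule.mem_span_singleton.1 h
  rw [norm_smul, hα, mul_one, Real.norm_eq_abs] at hβ
  rcases eq_or_eq_neg_of_abs_eq hβ with rfl | rfl
  · right; simp
  · left; simp

lemma finite_unit_refl_mem [Finite W] : {α : E | ‖α‖ = 1 ∧ refl α ∈ W}.Finite := by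
  refine Set.Finite.of_finite_fibers refl ?_ ?_
  · refine (Set.toFinite (W : Set (E ≃ₗᵢ[ℝ] E))).subset ?_
    rintro _ ⟨α, hα, rfl⟩
    exact hα.2
  · rintro _ ⟨α, hα, rfl⟩
    refine (Set.toFinite {-α, α}).subset ?_
    rintro β ⟨hβ, hαβ⟩
    refine eq_or_eq_neg_of_norm_eq_one hα.1 hβ.1 (mem_span_singleton_of_refl_eq_neg ?_)
    rw [← show refl β = refl α from hαβ, refl_self]

/-- The roots are the unit normals of all reflections in `W`; they are stable because conjugating a
reflection by `w` moves its normal by `w`. -/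
theorem IsFiniteReflectionGroup.exists_isRootSystemOf (hW : IsFiniteReflectionGroup W) :
    ∃ Φ : Finset E, IsRootSystemOf Φ W := by
  obtain ⟨hfin, S, hS0, hS⟩ := hW
  have hmem {α : E} : α ∈ (finite_unit_refl_mem (W := W)).toFinset ↔ ‖α‖ = 1 ∧ refl α ∈ W :=
    Set.Finite.mem_toFinset _
  refine ⟨(finite_unit_refl_mem (W := W)).toFinset, ⟨?_, ?_, ?_⟩, ?_⟩
  · rintro α hα rfl
    simp [hmem] at hα
  · intro α hα
    have hα' := hmem.1 hα
    ext β
    constructor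
    · rintro ⟨hβ, hs⟩
      exact eq_or_eq_neg_of_norm_eq_one hα'.1 (hmem.1 hβ).1 hs
    · rintro (rfl | rfl)
      · exact ⟨hmem.2 (by rwa [norm_neg, refl_neg]), neg_mem (Submodule.mem_span_singleton_self _)⟩
      · exact ⟨hα, Submodule.mem_span_singleton_self _⟩
  · intro α hα
    have hα' := hmem.1 hα
    have hmap : ∀ β ∈ (finite_unit_refl_mem (W := W)).toFinset,
        refl α β ∈ (finite_unit_refl_mem (W := W)).toFinset := by
      intro β hβ
      rw [hmem] at hβ ⊢
      rw [refl_map, LinearIsometryEquiv.norm_map]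
      exact ⟨hβ.1, W.mul_mem (W.mul_mem hα'.2 hβ.2) (W.inv_mem hα'.2)⟩
    refine Set.Subset.antisymm ?_ fun β hβ ↦ ⟨refl α β, hmap β hβ, refl_refl α β⟩
    rintro _ ⟨β, hβ, rfl⟩
    exact hmap β hβ
  · refine le_antisymm ((Subgroup.closure_le W).2 ?_) ?_
    · rintro _ ⟨α, hα, rfl⟩
      exact (hmem.1 hα).2
    · nth_rewrite 1 [hS]
      refine Subgroup.closure_mono ?_
      rintro _ ⟨α, hα, rfl⟩
      have h0 : ‖α‖ ≠ 0 := norm_ne_zero_iff.2 (hS0 α hα)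
      have h1 : refl (‖α‖⁻¹ • α) = refl α := refl_smul α (inv_ne_zero h0)
      refine ⟨‖α‖⁻¹ • α, hmem.2 ⟨by rw [norm_smul, norm_inv, norm_norm, inv_mul_cancel₀ h0], ?_⟩, h1⟩
      rw [h1, hS]
      exact Subgroup.subset_closure ⟨α, hα, rfl⟩

/-! ## Restrictions to flats -/

lemma restriction_hyperplanes [FiniteDimensional ℝ E] (Φ : Finset E) (L : Submodule ℝ E) :
    restriction (hyperplanes Φ id) L =
      hyperplanes Φ fun γ ↦ L.orthogonalProjectionOnto γ := by
  have hcomap (γ : E) : ((ℝ ∙ γ)ᗮ).comap L.subtype = (ℝ ∙ L.orthogonalProjectionOnto γ)ᗮ := by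
    ext c
    rw [Submodule.mem_comap, Submodule.mem_orthogonal_singleton_iff_inner_right,
      Submodule.mem_orthogonal_singleton_iff_inner_right, inner_orthogonalProjectionOnto]
    rfl
  have hle (γ : E) : L ≤ (ℝ ∙ γ)ᗮ ↔ L.orthogonalProjectionOnto γ = 0 := by
    rw [orthogonalProjectionOnto_eq_zero_iff']
    exact forall₂_congr fun c _ ↦ Submodule.mem_orthogonal_singleton_iff_inner_right
  ext K
  constructor
  · rintro ⟨_, ⟨γ, hγ, -, rfl⟩, hL, rfl⟩
    exact ⟨γ, hγ, fun h0 ↦ hL ((hle γ).2 h0), hcomap γ⟩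
  · rintro ⟨γ, hγ, h0, rfl⟩
    refine ⟨_, ⟨γ, hγ, ?_, rfl⟩, fun hL ↦ h0 ((hle γ).1 hL), (hcomap γ).symm⟩
    exact fun h ↦ h0 ((congrArg L.orthogonalProjectionOnto h).trans (map_zero _))

/-- The reflections in the hyperplanes defining `L` lie in `W` and fix `c`, hence by equivariance
they fix its sign sum. -/
lemma IsRootSystemOf.signSum_mem_flat (h : IsRootSystemOf Φ W) {L : Submodule ℝ E}
    (hL : IsFlat (reflectionArrangement W) L) {c : E} (hc : c ∈ L) : signSum Φ id c ∈ L := by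
  obtain ⟨B, hB, rfl⟩ := hL
  rw [Submodule.mem_sInf] at hc ⊢
  intro H hH
  have hcH := hc H hH
  obtain ⟨α, -, hα, rfl⟩ := hB hH
  rw [← refl_eq_self_iff] at hcH ⊢
  rw [h.map_signSum hα, hcH]

lemma signSum_orthogonalProjectionOnto [FiniteDimensional ℝ E] (Φ : Finset E)
    (L : Submodule ℝ E) (c : L) :
    signSum Φ (fun γ ↦ L.orthogonalProjectionOnto γ) c =
      L.orthogonalProjectionOnto (signSum Φ id (c : E)) := by
  simp only [signSum, map_sum, map_smul, inner_orthogonalProjectionOnto, id]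

/-- At a generic point of `L` only the roots in `Lᗮ` vanish. After perturbation along `g` their
signs depend on `g` alone, so the same `r` serves every `c`. -/
lemma exists_signSum_perturb [FiniteDimensional ℝ E] {L : Submodule ℝ E} {g : E}
    (hg : IsGeneric Φ id g) :
    ∃ r ∈ Lᗮ, ∀ c : L, IsGeneric Φ (fun γ ↦ L.orthogonalProjectionOnto γ) c →
      ∃ b, IsGeneric Φ id b ∧ signSum Φ id b = signSum Φ id (c : E) + r := by
  classical
  refine ⟨∑ γ ∈ Φ with γ ∈ Lᗮ, sgn ⟪γ, g⟫_ℝ • γ, Submodule.sum_mem _ fun γ hγ ↦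
    Submodule.smul_mem _ _ (Finset.mem_filter.1 hγ).2, fun c hc ↦ ?_⟩
  obtain ⟨ε, hε, hs⟩ := exists_pos_forall_sgn_eq Φ id (c : E) g
  refine ⟨c + ε • g, isGeneric_perturb hg hε hs, ?_⟩
  rw [Finset.sum_filter, signSum, signSum, ← Finset.sum_add_distrib]
  refine Finset.sum_congr rfl fun γ hγ ↦ ?_
  by_cases hL : γ ∈ Lᗮ
  · have h0 : ⟪γ, (c : E)⟫_ℝ = 0 := (Submodule.mem_orthogonal' _ _).1 hL c c.2
    rw [if_pos hL, id, inner_add_right, h0, zero_add, sgn_zero, zero_smul, zero_add,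
      inner_smul_right]
    congr 1
    rcases lt_trichotomy ⟪γ, g⟫_ℝ 0 with h1 | h1 | h1
    · rw [sgn_neg h1, sgn_neg (mul_neg_of_pos_of_neg hε h1)]
    · rw [h1, mul_zero]
    · rw [sgn_pos h1, sgn_pos (mul_pos hε h1)]
  · rw [if_neg hL, add_zero, hs γ hγ]
    rw [id, ← inner_orthogonalProjectionOnto]
    refine hc γ hγ fun h0 ↦ hL ?_
    rw [orthogonalProjectionOnto_eq_zero_iff'] at h0
    exact (Submodule.mem_orthogonal' _ _).2 h0

/-- Sign sums of points of `L` lie in `L`, so projection leaves them unchanged; adding `r`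
orthogonally yields vertices of the Coxeter zonotope, whose norms agree. -/
lemma IsRootSystemOf.norm_signSum_flat_eq [FiniteDimensional ℝ E] [Finite W]
    (h : IsRootSystemOf Φ W) {L : Submodule ℝ E} (hL : IsFlat (reflectionArrangement W) L)
    (c c' : L) (hc : IsGeneric Φ (fun γ ↦ L.orthogonalProjectionOnto γ) c)
    (hc' : IsGeneric Φ (fun γ ↦ L.orthogonalProjectionOnto γ) c') :
    ‖signSum Φ (fun γ ↦ L.orthogonalProjectionOnto γ) c‖ =
      ‖signSum Φ (fun γ ↦ L.orthogonalProjectionOnto γ) c'‖ := by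
  obtain ⟨g, hg⟩ := exists_isGeneric Φ (id : E → E)
  obtain ⟨r, hr, hpert⟩ := exists_signSum_perturb (L := L) hg
  obtain ⟨b, hb, hbr⟩ := hpert c hc
  obtain ⟨b', hb', hbr'⟩ := hpert c' hc'
  have hmem := h.signSum_mem_flat hL c.2
  have hmem' := h.signSum_mem_flat hL c'.2
  have hnorm (v : E) (hv : v ∈ L) : ‖v + r‖ ^ 2 = ‖v‖ ^ 2 + ‖r‖ ^ 2 := by
    rw [norm_add_sq_real, (Submodule.mem_orthogonal _ _).1 hr v hv]
    ring
  have hproj (v : E) (hv : v ∈ L) : ‖L.orthogonalProjectionOnto v‖ = ‖v‖ := by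
    change ‖(L.orthogonalProjectionOnto v : E)‖ = ‖v‖
    rw [← Submodule.starProjection_apply,
      Submodule.starProjection_eq_self_iff.2 hv]
  have h1 := h.norm_signSum_eq hb hb'
  rw [signSum_orthogonalProjectionOnto, signSum_orthogonalProjectionOnto, hproj _ hmem,
    hproj _ hmem', ← sq_eq_sq₀ (norm_nonneg _) (norm_nonneg _)]
  have h2 := hnorm _ hmem
  have h3 := hnorm _ hmem'
  rw [← hbr, h1, hbr'] at h2
  linarith

theorem IsRootSystemOf.vertices_coxeterZonotope [FiniteDimensional ℝ E] [Finite W]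
    (h : IsRootSystemOf Φ W) :
    ∃ v : E, vertices (coxeterZonotope Φ) = {x | ∃ w ∈ W, x = w v} := by
  obtain ⟨g, hg⟩ := exists_isGeneric Φ (id : E → E)
  refine ⟨signSum Φ id g, ?_⟩
  rw [show coxeterZonotope Φ = zonotope Φ id from rfl, vertices_zonotope]
  ext x
  constructor
  · rintro ⟨c, hc, rfl⟩
    exact h.exists_signSum_eq hc hg
  · rintro ⟨w, hw, rfl⟩
    exact ⟨w g, h.isGeneric_map hw hg, (h.map_signSum hw g).symm⟩

end RootSystem

end InscribedArrangement

theorem mainTheorem3 {E : Type*} [NormedAddCommGroup E] [InnerProductSpace ℝ E]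
    [FiniteDimensional ℝ E] (W : Subgroup (E ≃ₗᵢ[ℝ] E))
    (hW : InscribedArrangement.IsFiniteReflectionGroup W) :
    (∃ Φ : Finset E, InscribedArrangement.IsRootSystemOf Φ W) ∧
    (∀ Φ : Finset E, InscribedArrangement.IsRootSystemOf Φ W →
      InscribedArrangement.IsZonotope (InscribedArrangement.coxeterZonotope Φ) ∧
      InscribedArrangement.normalFan (InscribedArrangement.coxeterZonotope Φ) =
        InscribedArrangement.arrangementFan (InscribedArrangement.reflectionArrangement W) ∧
      (∃ v : E, InscribedArrangement.vertices (InscribedArrangement.coxeterZonotope Φ) =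
        {x | ∃ w ∈ W, x = w v}) ∧
      InscribedArrangement.IsInscribed (InscribedArrangement.coxeterZonotope Φ)) ∧
    InscribedArrangement.StronglyInscribable (InscribedArrangement.reflectionArrangement W) ∧
    (∀ L : Submodule ℝ E,
      InscribedArrangement.IsFlat (InscribedArrangement.reflectionArrangement W) L →
      InscribedArrangement.StronglyInscribable
        (InscribedArrangement.restriction (InscribedArrangement.reflectionArrangement W) L)) := by
  have := hW.1
  obtain ⟨Ψ, hΨ⟩ := hW.exists_isRootSystemOf
  refine ⟨⟨Ψ, hΨ⟩, fun Φ hΦ ↦ ⟨InscribedArrangement.isZonotope_zonotope Φ id, ?_,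
    hΦ.vertices_coxeterZonotope,
    InscribedArrangement.isInscribed_zonotope fun _ _ hc hc' ↦ hΦ.norm_signSum_eq hc hc'⟩, ?_,
    fun L hL ↦ ?_⟩
  · rw [hΦ.reflectionArrangement_eq]
    exact InscribedArrangement.normalFan_zonotope_eq_arrangementFan Φ id
  · rw [hΨ.reflectionArrangement_eq]
    exact InscribedArrangement.stronglyInscribable_hyperplanes fun _ _ hc hc' ↦
      hΨ.norm_signSum_eq hc hc'
  · have hnorm := hΨ.norm_signSum_flat_eq hL
    rw [hΨ.reflectionArrangement_eq, InscribedArrangement.restriction_hyperplanes]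
    exact InscribedArrangement.stronglyInscribable_hyperplanes hnorm
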